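/- **Theorem (byzantine throughput under a correct primary).** Consider a parallel-leader BFT protocol with $n=3f+1$ replicas, each of which is a leader and a backup of all other leaders, after GST, in an epoch of $T=T(n)$ time units started by a correct primary (so that all correct replicas take part). At most $f$ replicas are byzantine. Computing power is the bottleneck: every correct replica computes or verifies exactly one authenticator (partial or combined signature) per time unit during the whole epoch, and verifies only relevant ones. *Costs.* For each of its own requests, a leader computes $3$ signatures (on the pre-prepare message, and its own partial signatures for prepare and commit) and verifies $2f$ prepare and $2f$ commit signatures of backups; if more backups answer, the surplus is ignored. Every correct backup performs $5$ operations: it verifies the pre-prepare, signs the prepare, verifies the prepared-certificate, signs the commit, and verifies the commit-certificate. After every $k$ requests of a leader ($k\ge 1$ a constant) a checkpoint is created, for which the leader verifies $2f$ signatures and computes $2$ (its own partial signature and the combined one), and every correct backup computes $1$ and verifies $1$. Requests and checkpoints of correct leaders are counted pro rata (as real amounts). *Byzantine replicas* may behave arbitrarily, under these rules. As backups they answer or not. For a byzantine leader, a correct backup performs each of the above operations at most once per local sequence number (respectively checkpoint); it accepts a pre-prepare only for sequence numbers at most $2k$ above the last stable checkpoint of that leader known to it ($0$ if none); it signs a prepare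 only after accepting the pre-prepare, a commit only after verifying the prepared-certificate, and a checkpoint message only after verifying the commit-certificates of all requests up to that checkpoint; and each certificate requires $2f+1$ distinct signatures, where those of correct replicas cannot be forged. A request of a byzantine leader is committed if some correct replica verifies its commit-certificate. The *epoch throughput* is the number of requests committed by the system (from correct and byzantine leaders) divided by $T$. The *best-case* epoch throughput $\mathrm{best}(n)$ is its supremum over all such epochs with $n$ correct replicas; the *worst-case* epoch throughput $\mathrm{worst}(n)$ is its infimum over all such epochs with any at most $f$ byzantine replicas. Let $C_{\min}=C_{\min}(n)\in\Omega(n^2)$ be the minimum number of requests assigned to a leader, and let $T$ be such that, for every $f$, in some such epoch every correct leader commits at least $C_{\min}$ requests. Then: 1. $\displaystyle \mathrm{best}(n)=\frac{k(3f+1)}{k(19f+3)+(8f+2)}$ whenever $T>0$; 2. $\displaystyle \mathrm{worst}(n)=\frac{k(2f+1)}{k(14f+3)+(6f+2)}\left(1-\frac{8kf}{T}\right)$ whenever $T>0$ and $T\ge 8kf$; 3. $T\in\Omega(n^3)$; 4. $\displaystyle \lim_{n\to\infty}\frac{\mathrm{worst}(n)}{\mathrm{best}(n)}=\frac{16+38k}{18+42k}\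 \ge\ \frac{8}{9}$ (with $n=3f+1$, $f\to\infty$), i.e. the effective utilization under a correct primary is asymptotically at least $8/9$. -/

import Mathlib

open Filter Topology Asymptotics

/-!
A model of one epoch of a parallel-leader BFT protocol with `n = 3 f + 1` replicas after the
global stabilization time, in which computing power is the bottleneck: every correct replica
computes or verifies one authenticator (partial or combined signature) per time unit, for the
whole duration of the epoch, and verifies only the authenticators of relevant messages.
-/

/-- The `n = 3 f + 1` replicas. Each of them is a leader, and a backup of all other leaders. -/
abbrev Replica (f : ℕ) : Type := Fin (3 * f + 1)

/-- The authenticator operations of a backup on one request of a leader: it verifies the leader's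
pre-prepare message, computes its partial signature for its prepare message, verifies the
prepared-certificate, computes its partial signature for its commit message, and verifies the
commit-certificate. -/
inductive BackupOp : Type
  | verifyPrePrepare
  | signPrepare
  | verifyPreparedCert
  | signCommit
  | verifyCommitCert
  deriving DecidableEq

instance : Fintype BackupOp :=
  ⟨{.verifyPrePrepare, .signPrepare, .verifyPreparedCert, .signCommit, .verifyCommitCert}, fun x => by cases x <;> decide⟩

/-- The authenticator operations of a backup on one checkpoint of a leader: it computes its
partial signature for its checkpoint message, and verifies the checkpoint-certificate. -/
inductive BackupCheckpointOp : Type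
  | signCheckpoint
  | verifyCheckpointCert
  deriving DecidableEq

instance : Fintype BackupCheckpointOp :=
  ⟨{.signCheckpoint, .verifyCheckpointCert}, fun x => by cases x <;> decide⟩

/-- The signatures computed by a leader for one of its own requests: on the pre-prepare message,
and its own partial signatures of the backup prepare phase and of the commit phase. -/
inductive LeaderSignature : Type
  | prePrepare
  | prepare
  | commit
  deriving DecidableEq

instance : Fintype LeaderSignature :=
  ⟨{.prePrepare, .prepare, .commit}, fun x => by cases x <;> decide⟩

/-- The signatures computed by a leader for one of its own checkpoints: its own partial signature
and the combined signature of the certificate. -/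
inductive LeaderCheckpointSignature : Type
  | share
  | combined
  deriving DecidableEq

instance : Fintype LeaderCheckpointSignature :=
  ⟨{.share, .combined}, fun x => by cases x <;> decide⟩

/-- The three occasions on which a leader collects partial signatures from its backups. -/
inductive CollectPhase : Type
  | prepare
  | commit
  | checkpoint
  deriving DecidableEq

/-- What happens during one epoch that a correct primary started after the global stabilization
time; all correct replicas therefore take part in the epoch. Here `k` is the checkpoint period:
a checkpoint is due after every `k` requests of a leader, and the high watermark of a leader
lies `2 k` above its last stable checkpoint.

At most `f` replicas are byzantine. Their behaviour is arbitrary, except that messages must be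
relevant to be processed, and that signatures cannot be forged: a `(2 f + 1, n)` threshold
certificate exists only if, apart from byzantine replicas, enough correct ones signed. -/
structure EpochRun (f k : ℕ) where
  /-- the byzantine replicas -/
  byz : Finset (Replica f)
  byz_card : byz.card ≤ f
  /-- the primary that started the epoch -/
  primary : Replica f
  primary_correct : primary ∉ byz
  /-- the backups that answer leader `v` in a given phase: all correct ones, and those byzantine
  ones that choose to -/
  responders : CollectPhase → Replica f → Finset (Replica f)
  not_self_mem_responders : ∀ p v, v ∉ responders p v
  correct_mem_responders : ∀ p, ∀ v ∉ byz, ∀ u ∉ byz, u ≠ v → u ∈ responders p v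
  /-- the amount of requests committed by a correct leader `v` (not used for byzantine `v`);
  a request in progress is counted pro rata, so this is a real number -/
  amount : Replica f → ℝ
  amount_nonneg : ∀ v ∉ byz, 0 ≤ amount v
  /-- `(s, o) ∈ ops u b`: the correct replica `u` performs `o` on the request with local sequence
  number `s` of the byzantine leader `b` -/
  ops : Replica f → Replica f → Finset (ℕ × BackupOp)
  /-- `(j, o) ∈ checkpointOps u b`: the correct replica `u` performs `o` on the `j`-th checkpoint
  of the byzantine leader `b`, which follows the request with local sequence number `j * k` -/
  checkpointOps : Replica f → Replica f → Finset (ℕ × BackupCheckpointOp)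
  /-- sequence numbers of requests start with `1` -/
  one_le_seq : ∀ u ∉ byz, ∀ b ∈ byz, ∀ s o, (s, o) ∈ ops u b → 1 ≤ s
  /-- so do those of checkpoints -/
  one_le_checkpoint : ∀ u ∉ byz, ∀ b ∈ byz, ∀ j o, (j, o) ∈ checkpointOps u b → 1 ≤ j
  /-- a backup accepts a pre-prepare message only up to the high watermark, which is `2 k` plus
  the sequence number of the last stable checkpoint known to the backup -/
  watermark : ∀ u ∉ byz, ∀ b ∈ byz, ∀ s, (s, .verifyPrePrepare) ∈ ops u b →
    s ≤ 2 * k ∨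
      ∃ j, (j, .verifyCheckpointCert) ∈ checkpointOps u b ∧ s ≤ j * k + 2 * k
  /-- a prepare message answers a pre-prepare message -/
  signPrepare_after : ∀ u ∉ byz, ∀ b ∈ byz, ∀ s,
    (s, .signPrepare) ∈ ops u b → (s, .verifyPrePrepare) ∈ ops u b
  /-- a prepared-certificate combines `2 f + 1` partial signatures of prepare messages -/
  preparedCert_quorum : ∀ u ∉ byz, ∀ b ∈ byz, ∀ s, (s, .verifyPreparedCert) ∈ ops u b →
    2 * f + 1 ≤ byz.card + {w ∈ byzᶜ | (s, .signPrepare) ∈ ops w b}.card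
  /-- a commit message answers a prepared-certificate -/
  signCommit_after : ∀ u ∉ byz, ∀ b ∈ byz, ∀ s,
    (s, .signCommit) ∈ ops u b → (s, .verifyPreparedCert) ∈ ops u b
  /-- a commit-certificate combines `2 f + 1` partial signatures of commit messages -/
  commitCert_quorum : ∀ u ∉ byz, ∀ b ∈ byz, ∀ s, (s, .verifyCommitCert) ∈ ops u b →
    2 * f + 1 ≤ byz.card + {w ∈ byzᶜ | (s, .signCommit) ∈ ops w b}.card
  /-- a checkpoint message is signed only after all requests up to the checkpoint have been
  committed locally -/
  signCheckpoint_after : ∀ u ∉ byz, ∀ b ∈ byz, ∀ j,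
    (j, .signCheckpoint) ∈ checkpointOps u b →
      ∀ s, 1 ≤ s → s ≤ j * k → (s, .verifyCommitCert) ∈ ops u b
  /-- a checkpoint-certificate combines `2 f + 1` partial signatures of checkpoint messages -/
  checkpointCert_quorum : ∀ u ∉ byz, ∀ b ∈ byz, ∀ j,
    (j, .verifyCheckpointCert) ∈ checkpointOps u b →
      2 * f + 1 ≤ byz.card + {w ∈ byzᶜ | (j, .signCheckpoint) ∈ checkpointOps w b}.card

noncomputable section

namespace EpochRun

variable {f k : ℕ} (E : EpochRun f k)

/-- The number of partial signatures verified by leader `v` in a phase: those of the responding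
backups, but no more than the `2 f` that it needs in addition to its own. -/
def numVerified (p : CollectPhase) (v : Replica f) : ℕ := min (2 * f) (E.responders p v).card

/-- The number of authenticators that leader `v` processes for one of its own requests. -/
def leaderRequestCost (v : Replica f) : ℕ :=
  Fintype.card LeaderSignature + E.numVerified .prepare v + E.numVerified .commit v

/-- The number of authenticators that leader `v` processes for one of its own checkpoints. -/
def leaderCheckpointCost (v : Replica f) : ℕ :=
  Fintype.card LeaderCheckpointSignature + E.numVerified .checkpoint v

/-- The number of authenticators that the correct replica `u` processes during the epoch: as a
leader, as a backup of the other correct leaders (one checkpoint per `k` requests in both cases),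
and as a backup of the byzantine leaders. -/
def load (u : Replica f) : ℝ :=
  E.amount u * E.leaderRequestCost u + E.amount u / k * E.leaderCheckpointCost u
    + ∑ v ∈ E.byzᶜ.erase u,
        (E.amount v * Fintype.card BackupOp + E.amount v / k * Fintype.card BackupCheckpointOp)
    + ∑ b ∈ E.byz, (((E.ops u b).card : ℝ) + ((E.checkpointOps u b).card : ℝ))

/-- The epoch lasts `T` time units, and every correct replica works at its full potential (one
authenticator per time unit) all the time. -/
def Lasts (T : ℝ) : Prop := ∀ u ∉ E.byz, E.load u = T

/-- The sequence numbers of the requests of the byzantine leader `b` that become committed, that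
is, for which some correct replica obtains the commit-certificate. -/
def committedOf (b : Replica f) : Finset ℕ :=
  E.byzᶜ.biUnion fun u => ((E.ops u b).filter fun x => x.2 = .verifyCommitCert).image Prod.fst

/-- The number of requests committed by the system per time unit in an epoch of length `T`. -/
def throughput (T : ℝ) : ℝ :=
  (∑ v ∈ E.byzᶜ, E.amount v + ∑ b ∈ E.byz, ((E.committedOf b).card : ℝ)) / T

end EpochRun

/-- The best-case epoch throughput: all `3 f + 1` replicas are correct. -/
def bestCaseThroughput (f k : ℕ) (T : ℝ) : ℝ :=
  sSup {r | ∃ E : EpochRun f k, E.Lasts T ∧ E.byz = ∅ ∧ E.throughput T = r}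

/-- The worst-case epoch throughput: any at most `f` replicas are byzantine, and behave in any
way. -/
def worstCaseThroughput (f k : ℕ) (T : ℝ) : ℝ :=
  sInf {r | ∃ E : EpochRun f k, E.Lasts T ∧ E.throughput T = r}

/-- In an epoch of length `T` the correct replicas can commit `C` requests each. -/
def CanFinish (f k : ℕ) (T : ℝ) (C : ℕ) : Prop :=
  ∃ E : EpochRun f k, E.Lasts T ∧ ∀ v ∉ E.byz, (C : ℝ) ≤ E.amount v

end

namespace EpochRun

variable {f k : ℕ}

/-! The theorem is a balance of work. Let `m` replicas be correct, `S` the amount committed by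
correct leaders and `C` the number of requests committed by byzantine ones. With `β = 5 + 2/k` the
cost of a request to a backup and `α` the extra cost to its leader, adding the loads of all correct
replicas gives `(α + β m) S + W = m T`, where `W` is the work spent on byzantine leaders
(`Lasts.total_work`). Without byzantine replicas `W = 0`, so the throughput is determined.

In general, a byzantine leader can waste at most `8 k` operations per correct backup: 4 of the 5
operations on each of the `2 k` requests between its last checkpoint and the watermark. All other
work on it is paid for by commits (`byzantine_work_le`). Hence `S + C ≥ m (T - 8kf) / (α + β m)`,
which is least at `m = 2f + 1`; `stallingRun` attains this value.

Finally, the load of one correct replica forces `T ≥ (3f + 1) Cmin`, so `T` is at least cubic, the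
loss `8kf/T` vanishes, and only the ratio of the coefficients survives in the limit. -/

theorem exists_correct_of_quorum (E : EpochRun f k) {p : Replica f → Prop} [DecidablePred p]
    (h : 2 * f + 1 ≤ E.byz.card + {w ∈ E.byzᶜ | p w}.card) : ∃ w ∉ E.byz, p w := by
  have hpos : 0 < {w ∈ E.byzᶜ | p w}.card := by
    have := E.byz_card
    omega
  obtain ⟨w, hw⟩ := Finset.card_pos.mp hpos
  rw [Finset.mem_filter, Finset.mem_compl] at hw
  exact ⟨w, hw⟩

theorem mem_committedOf (E : EpochRun f k) {b : Replica f} {s : ℕ} :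
    s ∈ E.committedOf b ↔ ∃ u ∉ E.byz, (s, BackupOp.verifyCommitCert) ∈ E.ops u b := by
  simp [committedOf]

/-- Every operation on a request goes back to a pre-prepare message accepted by some correct
replica. -/
theorem exists_verifyPrePrepare (E : EpochRun f k) {u b : Replica f} (hu : u ∉ E.byz)
    (hb : b ∈ E.byz) {s : ℕ} {o : BackupOp} (h : (s, o) ∈ E.ops u b) :
    ∃ w ∉ E.byz, (s, BackupOp.verifyPrePrepare) ∈ E.ops w b := by
  have of_prepared : ∀ w ∉ E.byz, (s, BackupOp.verifyPreparedCert) ∈ E.ops w b →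
      ∃ w ∉ E.byz, (s, BackupOp.verifyPrePrepare) ∈ E.ops w b := fun w hw hs => by
    obtain ⟨x, hx, hxs⟩ := E.exists_correct_of_quorum (E.preparedCert_quorum w hw b hb s hs)
    exact ⟨x, hx, E.signPrepare_after x hx b hb s hxs⟩
  cases o with
  | verifyPrePrepare => exact ⟨u, hu, h⟩
  | signPrepare => exact ⟨u, hu, E.signPrepare_after u hu b hb s h⟩
  | verifyPreparedCert => exact of_prepared u hu h
  | signCommit => exact of_prepared u hu (E.signCommit_after u hu b hb s h)
  | verifyCommitCert =>
    obtain ⟨w, hw, hws⟩ := E.exists_correct_of_quorum (E.commitCert_quorum u hu b hb s h)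
    exact of_prepared w hw (E.signCommit_after w hw b hb s hws)

/-- All requests up to a checkpoint on which a correct replica operates are committed. -/
theorem Icc_subset_committedOf (E : EpochRun f k) {u b : Replica f} (hu : u ∉ E.byz)
    (hb : b ∈ E.byz) {j : ℕ} {o : BackupCheckpointOp} (h : (j, o) ∈ E.checkpointOps u b) :
    Finset.Icc 1 (j * k) ⊆ E.committedOf b := by
  have of_sign : ∀ w ∉ E.byz, (j, BackupCheckpointOp.signCheckpoint) ∈ E.checkpointOps w b →
      Finset.Icc 1 (j * k) ⊆ E.committedOf b := fun w hw hj s hs => by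
    rw [Finset.mem_Icc] at hs
    exact E.mem_committedOf.mpr ⟨w, hw, E.signCheckpoint_after w hw b hb j hj s hs.1 hs.2⟩
  cases o with
  | signCheckpoint => exact of_sign u hu h
  | verifyCheckpointCert =>
    obtain ⟨w, hw, hwj⟩ := E.exists_correct_of_quorum (E.checkpointCert_quorum u hu b hb j h)
    exact of_sign w hw hwj

/-- There is a last checkpoint `J` of a byzantine leader: all requests up to it are committed,
and no correct replica gets beyond the corresponding high watermark. -/
theorem exists_last_checkpoint (E : EpochRun f k) (hk : 0 < k) {b : Replica f} (hb : b ∈ E.byz) :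
    ∃ J, J * k ≤ (E.committedOf b).card ∧
      (∀ u ∉ E.byz, ∀ j o, (j, o) ∈ E.checkpointOps u b → j ≤ J) ∧
      ∀ u ∉ E.byz, ∀ s o, (s, o) ∈ E.ops u b → s ≤ J * k + 2 * k := by
  classical
  have card_le : ∀ j, Finset.Icc 1 (j * k) ⊆ E.committedOf b → j * k ≤ (E.committedOf b).card :=
    fun j hj => by simpa using Finset.card_le_card hj
  let P : ℕ → Prop := fun j => Finset.Icc 1 (j * k) ⊆ E.committedOf b
  -- `J` is defined by commitment rather than by existing checkpoints, which it dominates. The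
  -- search bound suffices because `j ≤ j * k ≤ card`.
  have hJ : P (Nat.findGreatest P (E.committedOf b).card) :=
    Nat.findGreatest_spec (m := 0) (Nat.zero_le _) (by simp [P])
  have checkpoint_le : ∀ u ∉ E.byz, ∀ j o, (j, o) ∈ E.checkpointOps u b →
      j ≤ Nat.findGreatest P (E.committedOf b).card := fun u hu j o h =>
    have hj := E.Icc_subset_committedOf hu hb h
    Nat.le_findGreatest ((Nat.le_mul_of_pos_right j hk).trans (card_le j hj)) hj
  refine ⟨_, card_le _ hJ, checkpoint_le, fun u hu s o h => ?_⟩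
  obtain ⟨w, hw, hws⟩ := E.exists_verifyPrePrepare hu hb h
  rcases E.watermark w hw b hb s hws with h2 | ⟨j, hj, hs⟩
  · exact h2.trans (Nat.le_add_left _ _)
  · exact hs.trans (Nat.add_le_add_right (Nat.mul_le_mul_right k (checkpoint_le w hw j _ hj)) _)

/-! ### Work wasted by a byzantine leader -/

theorem card_backupOp : Fintype.card BackupOp = 5 := rfl

theorem card_backupCheckpointOp : Fintype.card BackupCheckpointOp = 2 := rfl

theorem card_leaderSignature : Fintype.card LeaderSignature = 3 := rfl

theorem card_leaderCheckpointSignature : Fintype.card LeaderCheckpointSignature = 2 := rfl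

/-- A byzantine leader wastes at most `8 k` operations of a correct backup beyond the regular cost
of the requests that it commits. -/
theorem byzantine_work_le (E : EpochRun f k) (hk : 0 < k) {u b : Replica f} (hu : u ∉ E.byz)
    (hb : b ∈ E.byz) :
    ((E.ops u b).card : ℝ) + ((E.checkpointOps u b).card : ℝ)
      ≤ 8 * k + (5 + 2 / k) * ((E.committedOf b).card : ℝ) := by
  obtain ⟨J, hJ, hcp, hop⟩ := E.exists_last_checkpoint hk hb
  have hsub : E.committedOf b ⊆ Finset.Icc 1 (J * k + 2 * k) := fun s hs => by
    obtain ⟨w, hw, h⟩ := E.mem_committedOf.mp hs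
    exact Finset.mem_Icc.mpr ⟨E.one_le_seq w hw b hb s _ h, hop w hw s _ h⟩
  -- A committed request costs at most 5 operations; an uncommitted one at most 4, since nobody
  -- correct verifies its commit-certificate.
  have hops : E.ops u b ⊆ E.committedOf b ×ˢ Finset.univ ∪
      (Finset.Icc 1 (J * k + 2 * k) \ E.committedOf b) ×ˢ
        Finset.univ.erase BackupOp.verifyCommitCert := by
    rintro ⟨s, o⟩ h
    by_cases hs : s ∈ E.committedOf b
    · exact Finset.mem_union_left _ (Finset.mem_product.mpr ⟨hs, Finset.mem_univ _⟩)
    · refine Finset.mem_union_right _ (Finset.mem_product.mpr ⟨Finset.mem_sdiff.mpr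
        ⟨Finset.mem_Icc.mpr ⟨E.one_le_seq u hu b hb s o h, hop u hu s o h⟩, hs⟩,
        Finset.mem_erase.mpr ⟨?_, Finset.mem_univ _⟩⟩)
      rintro rfl
      exact hs (E.mem_committedOf.mpr ⟨u, hu, h⟩)
  have hcps : E.checkpointOps u b ⊆ Finset.Icc 1 J ×ˢ Finset.univ := by
    rintro ⟨j, o⟩ h
    exact Finset.mem_product.mpr ⟨Finset.mem_Icc.mpr
      ⟨E.one_le_checkpoint u hu b hb j o h, hcp u hu j o h⟩, Finset.mem_univ _⟩
  have h1 := (Finset.card_le_card hops).trans (Finset.card_union_le _ _)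
  have h2 := Finset.card_le_card hcps
  have h3 := Finset.card_le_card hsub
  rw [Finset.card_product, Finset.card_product, Finset.card_erase_of_mem (Finset.mem_univ _),
    Finset.card_sdiff_of_subset hsub, Finset.card_univ, card_backupOp] at h1
  rw [Finset.card_product, Finset.card_univ, card_backupCheckpointOp] at h2
  simp only [Nat.card_Icc, Nat.add_sub_cancel] at h1 h2 h3
  -- With `c` committed requests, `5c + 4(Jk + 2k - c) = c + 4Jk + 8k ≤ 5c + 8k`, by `Jk ≤ c`.
  have h4 : (E.ops u b).card + (E.checkpointOps u b).card
      ≤ 8 * k + 5 * (E.committedOf b).card + 2 * J := by omega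
  have hk' : (0 : ℝ) < k := Nat.cast_pos.mpr hk
  have h5 : (J : ℝ) ≤ (E.committedOf b).card / k := by
    rw [le_div_iff₀ hk']
    exact_mod_cast hJ
  have h6 : ((E.ops u b).card : ℝ) + (E.checkpointOps u b).card
      ≤ 8 * k + 5 * (E.committedOf b).card + 2 * J := by exact_mod_cast h4
  calc _ ≤ _ := h6
    _ ≤ 8 * k + 5 * ((E.committedOf b).card : ℝ) + 2 * ((E.committedOf b).card / k) := by linarith
    _ = _ := by ring

/-! ### Work balance of the correct replicas -/

theorem card_compl_byz (E : EpochRun f k) : E.byzᶜ.card + E.byz.card = 3 * f + 1 := by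
  rw [Finset.card_compl_add_card, Fintype.card_fin]

/-- At least `2f` other correct replicas always answer, and the surplus is ignored, so byzantine
backups cannot affect the cost of a correct leader. -/
theorem numVerified_eq (E : EpochRun f k) (p : CollectPhase) {v : Replica f} (hv : v ∉ E.byz) :
    E.numVerified p v = 2 * f := by
  have hsub : E.byzᶜ.erase v ⊆ E.responders p v := fun u hu => by
    rw [Finset.mem_erase, Finset.mem_compl] at hu
    exact E.correct_mem_responders p v hv u hu.2 hu.1
  have h := Finset.card_le_card hsub
  rw [Finset.card_erase_of_mem (Finset.mem_compl.mpr hv)] at h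
  have := E.card_compl_byz
  have := E.byz_card
  rw [numVerified]
  omega

/-- Treating `u` as a backup of itself as well makes the sum run over all correct leaders; the first
coefficient is the excess of leader cost over backup cost. -/
theorem load_eq (E : EpochRun f k) {u : Replica f} (hu : u ∉ E.byz) :
    E.load u = (4 * f - 2 + 2 * f / k) * E.amount u + (5 + 2 / k) * ∑ v ∈ E.byzᶜ, E.amount v
      + ∑ b ∈ E.byz, (((E.ops u b).card : ℝ) + ((E.checkpointOps u b).card : ℝ)) := by
  have hmem : u ∈ E.byzᶜ := Finset.mem_compl.mpr hu
  have hsum : ∑ v ∈ E.byzᶜ.erase u, (E.amount v * 5 + E.amount v / k * 2)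
      = (5 + 2 / k) * (∑ v ∈ E.byzᶜ, E.amount v - E.amount u) := by
    rw [← Finset.add_sum_erase _ _ hmem, add_sub_cancel_left, Finset.mul_sum]
    exact Finset.sum_congr rfl fun v _ => by ring
  simp only [load, leaderRequestCost, leaderCheckpointCost, E.numVerified_eq _ hu, card_backupOp,
    card_backupCheckpointOp, card_leaderSignature, card_leaderCheckpointSignature]
  push_cast
  rw [hsum]
  ring

/-- The total work of the correct replicas. -/
theorem Lasts.total_work {E : EpochRun f k} {T : ℝ} (h : E.Lasts T) :
    (4 * f - 2 + 2 * f / k + (5 + 2 / k) * (E.byzᶜ.card : ℝ)) * ∑ v ∈ E.byzᶜ, E.amount v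
      + ∑ u ∈ E.byzᶜ, ∑ b ∈ E.byz,
          (((E.ops u b).card : ℝ) + ((E.checkpointOps u b).card : ℝ))
      = E.byzᶜ.card * T := by
  have hsum : ∑ u ∈ E.byzᶜ, E.load u = E.byzᶜ.card * T := by
    rw [Finset.sum_congr rfl fun u hu => h u (Finset.mem_compl.mp hu), Finset.sum_const,
      nsmul_eq_mul]
  rw [← hsum, Finset.sum_congr rfl fun u hu => E.load_eq (Finset.mem_compl.mp hu),
    Finset.sum_add_distrib, Finset.sum_add_distrib, ← Finset.mul_sum, Finset.sum_const,
    nsmul_eq_mul]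
  ring

theorem total_byzantine_work_le (E : EpochRun f k) (hk : 0 < k) :
    ∑ u ∈ E.byzᶜ, ∑ b ∈ E.byz, (((E.ops u b).card : ℝ) + ((E.checkpointOps u b).card : ℝ))
      ≤ E.byzᶜ.card * (8 * k * E.byz.card
          + (5 + 2 / k) * ∑ b ∈ E.byz, ((E.committedOf b).card : ℝ)) := by
  rw [← nsmul_eq_mul]
  refine Finset.sum_le_card_nsmul _ _ _ fun u hu => ?_
  refine (Finset.sum_le_sum fun b hb =>
    E.byzantine_work_le hk (Finset.mem_compl.mp hu) hb).trans_eq ?_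
  rw [Finset.sum_add_distrib, Finset.sum_const, nsmul_eq_mul, ← Finset.mul_sum]
  ring

/-- The amount of requests committed without byzantine replicas. -/
theorem Lasts.sum_amount_of_byz_eq_empty {E : EpochRun f k} {T : ℝ} (hk : 0 < k) (h : E.Lasts T)
    (hE : E.byz = ∅) :
    ∑ v ∈ E.byzᶜ, E.amount v
      = (k * (3 * f + 1) : ℝ) / (k * (19 * f + 3) + (8 * f + 2)) * T := by
  have hw := h.total_work
  have hcard := E.card_compl_byz
  rw [hE, Finset.card_empty, add_zero] at hcard
  rw [hE] at hw ⊢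
  rw [hcard] at hw
  push_cast at hw
  have hk' : (0 : ℝ) < k := Nat.cast_pos.mpr hk
  simp only [Finset.sum_empty, Finset.sum_const_zero, add_zero] at hw
  rw [div_mul_eq_mul_div, eq_div_iff (by positivity)]
  field_simp at hw
  linear_combination hw

/-- Lower bound on the number of requests committed in any epoch. -/
theorem Lasts.committed_ge {E : EpochRun f k} {T : ℝ} (hk : 0 < k) (h : E.Lasts T)
    (hT : 8 * k * f ≤ T) :
    (k * (2 * f + 1) : ℝ) / (k * (14 * f + 3) + (6 * f + 2)) * (T - 8 * k * f)
      ≤ ∑ v ∈ E.byzᶜ, E.amount v + ∑ b ∈ E.byz, ((E.committedOf b).card : ℝ) := by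
  have hk' : (0 : ℝ) < k := Nat.cast_pos.mpr hk
  have hw := h.total_work
  have hb := E.total_byzantine_work_le hk
  have hcard : (E.byzᶜ.card : ℝ) + E.byz.card = 3 * f + 1 := by exact_mod_cast E.card_compl_byz
  have hbf : (E.byz.card : ℝ) ≤ f := by exact_mod_cast E.byz_card
  have hC : 0 ≤ ∑ b ∈ E.byz, ((E.committedOf b).card : ℝ) := by positivity
  have hC0 : f = 0 → ∑ b ∈ E.byz, ((E.committedOf b).card : ℝ) = 0 := fun hf => by
    have h0 : E.byz = ∅ := Finset.card_eq_zero.mp (by have := E.byz_card; omega)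
    rw [h0, Finset.sum_empty]
  set S := ∑ v ∈ E.byzᶜ, E.amount v
  set C := ∑ b ∈ E.byz, ((E.committedOf b).card : ℝ)
  set t := (E.byz.card : ℝ)
  set m := (E.byzᶜ.card : ℝ)
  set W := ∑ u ∈ E.byzᶜ, ∑ b ∈ E.byz,
    (((E.ops u b).card : ℝ) + ((E.checkpointOps u b).card : ℝ))
  have hm : 2 * (f : ℝ) + 1 ≤ m := by linarith
  have hf0 : (0 : ℝ) ≤ f := Nat.cast_nonneg f
  set α : ℝ := 4 * f - 2 + 2 * f / k with hα
  set β : ℝ := 5 + 2 / k with hβ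
  have hβ0 : 0 < β := by positivity
  -- For `f = 0` the coefficient `α` is `-2`, but then `C = 0` and `m = 1 = 2f + 1`.
  have hαC : 0 ≤ α * C ∧ 0 ≤ α * (m - (2 * f + 1)) := by
    rcases Nat.eq_zero_or_pos f with hf | hf
    · have ht : 0 ≤ t := Nat.cast_nonneg _
      have : (f : ℝ) = 0 := by exact_mod_cast hf
      have hm1 : m - (2 * f + 1) = 0 := by linarith
      rw [hC0 hf, hm1]
      simp
    · have hf1 : (1 : ℝ) ≤ f := by exact_mod_cast hf
      have : 0 ≤ 2 * (f : ℝ) / k := by positivity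
      have hα0 : 0 ≤ α := by linarith
      exact ⟨mul_nonneg hα0 hC, mul_nonneg hα0 (by linarith)⟩
  have hq : 0 < α + β * (2 * f + 1) := by
    have : α + β * (2 * f + 1) = (k * (14 * f + 3) + (6 * f + 2)) / k := by
      rw [hα, hβ]
      field_simp
      ring
    rw [this]
    positivity
  have hD : 0 < α + β * m := by nlinarith
  have key : m * (T - 8 * k * f) ≤ (α + β * m) * (S + C) := by
    have h1 : m * (8 * k * t) ≤ m * (8 * k * f) := by gcongr
    nlinarith [hαC.1]
  have hfrac : (k * (2 * f + 1) : ℝ) / (k * (14 * f + 3) + (6 * f + 2))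
      = (2 * f + 1) / (α + β * (2 * f + 1)) := by
    rw [div_eq_div_iff (by positivity) hq.ne', hα, hβ]
    field_simp
    ring
  rw [hfrac]
  calc (2 * f + 1) / (α + β * (2 * f + 1)) * (T - 8 * k * f)
      ≤ m / (α + β * m) * (T - 8 * k * f) := by
        refine mul_le_mul_of_nonneg_right ?_ (by linarith)
        rw [div_le_div_iff₀ hq hD]
        -- After cross-multiplication the `β` terms cancel, leaving `α (2f + 1) ≤ α m`.
        nlinarith [hαC.2]
    _ ≤ S + C := by
        rw [div_mul_eq_mul_div, div_le_iff₀ hD]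
        linarith

/-! ### The extremal epoch -/

/-- The operations of a correct backup of a byzantine leader that makes it work on as many requests
as the high watermark allows, but withholds all commit-certificates. -/
def stalledOps (k : ℕ) : Finset (ℕ × BackupOp) :=
  Finset.Icc 1 (2 * k) ×ˢ Finset.univ.erase BackupOp.verifyCommitCert

theorem mem_stalledOps {s : ℕ} {o : BackupOp} :
    (s, o) ∈ stalledOps k ↔ (1 ≤ s ∧ s ≤ 2 * k) ∧ o ≠ .verifyCommitCert := by
  simp [stalledOps]

theorem card_stalledOps : (stalledOps k).card = 8 * k := by
  rw [stalledOps, Finset.card_product, Finset.card_erase_of_mem (Finset.mem_univ _),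
    Finset.card_univ, card_backupOp, Nat.card_Icc]
  omega

theorem quorum_of_forall (B : Finset (Replica f)) {p : Prop} [Decidable p] (hp : p) :
    2 * f + 1 ≤ B.card + {_w ∈ Bᶜ | p}.card := by
  rw [Finset.filter_true_of_mem fun _ _ => hp, Finset.card_add_card_compl, Fintype.card_fin]
  omega

/-- The epoch in which all byzantine leaders stall their requests, and every correct leader
commits the amount `a` of requests. -/
def stallingRun (k : ℕ) (B : Finset (Replica f)) (hB : B.card ≤ f) (p : Replica f) (hp : p ∉ B)
    (a : ℝ) (ha : 0 ≤ a) : EpochRun f k where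
  byz := B
  byz_card := hB
  primary := p
  primary_correct := hp
  responders _ v := Finset.univ.erase v
  not_self_mem_responders _ v := Finset.notMem_erase v _
  correct_mem_responders _ _ _ _ _ h := Finset.mem_erase.mpr ⟨h, Finset.mem_univ _⟩
  amount _ := a
  amount_nonneg _ _ := ha
  ops _ _ := stalledOps k
  checkpointOps _ _ := ∅
  one_le_seq _ _ _ _ _ _ h := (mem_stalledOps.mp h).1.1
  one_le_checkpoint _ _ _ _ _ _ h := absurd h (Finset.notMem_empty _)
  watermark _ _ _ _ _ h := Or.inl (mem_stalledOps.mp h).1.2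
  signPrepare_after _ _ _ _ _ h := mem_stalledOps.mpr ⟨(mem_stalledOps.mp h).1, by decide⟩
  preparedCert_quorum _ _ _ _ _ h :=
    quorum_of_forall B (mem_stalledOps.mpr ⟨(mem_stalledOps.mp h).1, by decide⟩)
  signCommit_after _ _ _ _ _ h := mem_stalledOps.mpr ⟨(mem_stalledOps.mp h).1, by decide⟩
  commitCert_quorum _ _ _ _ _ h := absurd rfl (mem_stalledOps.mp h).2
  signCheckpoint_after _ _ _ _ _ h := absurd h (Finset.notMem_empty _)
  checkpointCert_quorum _ _ _ _ _ h := absurd h (Finset.notMem_empty _)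

section stallingRun

variable {B : Finset (Replica f)} {hB : B.card ≤ f} {p : Replica f} {hp : p ∉ B} {a : ℝ}
  {ha : 0 ≤ a}

theorem stallingRun_lasts {T : ℝ}
    (h : (4 * f - 2 + 2 * f / k + (5 + 2 / k) * (Bᶜ.card : ℝ)) * a = T - 8 * k * B.card) :
    (stallingRun k B hB p hp a ha).Lasts T := fun u hu => by
  rw [load_eq _ hu]
  simp only [stallingRun, card_stalledOps, Finset.sum_const, Finset.card_empty, nsmul_eq_mul]
  push_cast
  linear_combination h

theorem stallingRun_throughput (T : ℝ) :
    (stallingRun k B hB p hp a ha).throughput T = Bᶜ.card * a / T := by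
  have h : ∀ b, (stallingRun k B hB p hp a ha).committedOf b = ∅ := fun b => by
    refine Finset.eq_empty_of_forall_notMem fun s hs => ?_
    obtain ⟨u, -, hu⟩ := (mem_committedOf _).mp hs
    exact (mem_stalledOps.mp hu).2 rfl
  simp only [throughput, h, Finset.card_empty, Nat.cast_zero, Finset.sum_const_zero, add_zero]
  simp only [stallingRun, Finset.sum_const, nsmul_eq_mul]

end stallingRun

end EpochRun

/-! ### Exact values of the throughputs -/

open EpochRun in
theorem bestCaseThroughput_eq {f k : ℕ} (hk : 0 < k) {T : ℝ} (hT : 0 < T) :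
    bestCaseThroughput f k T = (k * (3 * f + 1) : ℝ) / (k * (19 * f + 3) + (8 * f + 2)) := by
  have hk' : (0 : ℝ) < k := Nat.cast_pos.mpr hk
  have huniq : ∀ E : EpochRun f k, E.Lasts T → E.byz = ∅ →
      E.throughput T = (k * (3 * f + 1) : ℝ) / (k * (19 * f + 3) + (8 * f + 2)) :=
    fun E hE h0 => by
      rw [throughput, hE.sum_amount_of_byz_eq_empty hk h0, h0, Finset.sum_empty, add_zero,
        mul_div_cancel_right₀ _ hT.ne']
  have hset : {r | ∃ E : EpochRun f k, E.Lasts T ∧ E.byz = ∅ ∧ E.throughput T = r}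
      = {(k * (3 * f + 1) : ℝ) / (k * (19 * f + 3) + (8 * f + 2))} := by
    ext r
    constructor
    · rintro ⟨E, hE, h0, rfl⟩
      exact huniq E hE h0
    · rintro rfl
      -- With no byzantine replicas the stalling epoch is an ordinary one; it shows that the set is
      -- nonempty.
      have hlasts : (stallingRun k (∅ : Finset (Replica f)) (by simp) 0 (by simp)
          (k / (k * (19 * f + 3) + (8 * f + 2)) * T) (by positivity)).Lasts T := by
        apply stallingRun_lasts
        rw [Finset.card_compl, Finset.card_empty, Fintype.card_fin]
        push_cast
        field_simp
        ring
      exact ⟨_, hlasts, rfl, huniq _ hlasts rfl⟩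
  rw [bestCaseThroughput, hset, csSup_singleton]

open EpochRun in
theorem worstCaseThroughput_eq {f k : ℕ} (hk : 0 < k) {T : ℝ} (hT : 0 < T)
    (hfT : 8 * k * f ≤ T) :
    worstCaseThroughput f k T =
      (k * (2 * f + 1) : ℝ) / (k * (14 * f + 3) + (6 * f + 2)) * (1 - 8 * k * f / T) := by
  have hk' : (0 : ℝ) < k := Nat.cast_pos.mpr hk
  refine IsLeast.csInf_eq ⟨?_, ?_⟩
  · obtain ⟨B, -, hB⟩ := Finset.exists_subset_card_eq
      (s := (Finset.univ : Finset (Replica f))) (n := f) (by simp; omega)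
    have hBc : Bᶜ.card = 2 * f + 1 := by
      rw [Finset.card_compl, hB, Fintype.card_fin]
      omega
    obtain ⟨p, hp⟩ : Bᶜ.Nonempty := Finset.card_pos.mp (by omega)
    -- This amount solves the load equation when `m = 2f + 1` and every correct replica wastes `8kf`
    -- operations.
    have ha : 0 ≤ (k : ℝ) / (k * (14 * f + 3) + (6 * f + 2)) * (T - 8 * k * f) :=
      mul_nonneg (by positivity) (by linarith)
    refine ⟨stallingRun k B hB.le p (Finset.mem_compl.mp hp) _ ha, ?_, ?_⟩
    · apply stallingRun_lasts
      rw [hBc, hB]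
      push_cast
      field_simp
      ring
    · rw [stallingRun_throughput, hBc]
      push_cast
      field_simp
  · rintro r ⟨E, hE, rfl⟩
    rw [throughput, le_div_iff₀ hT]
    refine le_trans (le_of_eq ?_) (hE.committed_ge hk hfT)
    field_simp

/-! ### Epoch length and asymptotics -/

/-- Committing `C` requests of each correct leader takes at least `n * C` time units. -/
theorem CanFinish.mul_le {f k : ℕ} {T : ℝ} {C : ℕ} (h : CanFinish f k T C) :
    (3 * (f : ℝ) + 1) * C ≤ T := by
  obtain ⟨E, hE, hC⟩ := h
  have hu := E.primary_correct
  have hf0 : (0 : ℝ) ≤ f := Nat.cast_nonneg f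
  have hcard : 2 * (f : ℝ) + 1 ≤ (E.byzᶜ.card : ℝ) := by
    have := E.card_compl_byz
    have := E.byz_card
    have h : 2 * f + 1 ≤ E.byzᶜ.card := by omega
    exact_mod_cast h
  have hsum : E.amount E.primary + 2 * f * C ≤ ∑ v ∈ E.byzᶜ, E.amount v := by
    have hmem : E.primary ∈ E.byzᶜ := Finset.mem_compl.mpr hu
    rw [← Finset.add_sum_erase _ _ hmem]
    have h1 : (E.byzᶜ.erase E.primary).card • (C : ℝ) ≤ ∑ v ∈ E.byzᶜ.erase E.primary, E.amount v :=
      Finset.card_nsmul_le_sum _ _ _ fun v hv =>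
        hC v (Finset.mem_compl.mp (Finset.mem_of_mem_erase hv))
    rw [nsmul_eq_mul, Finset.cast_card_erase_of_mem hmem] at h1
    have : 2 * (f : ℝ) * C ≤ ((E.byzᶜ.card : ℝ) - 1) * C := by gcongr; linarith
    linarith
  have ha := hC _ hu
  have hC0 : (0 : ℝ) ≤ C := Nat.cast_nonneg C
  have hS : 0 ≤ ∑ v ∈ E.byzᶜ, E.amount v :=
    Finset.sum_nonneg fun v hv => E.amount_nonneg v (Finset.mem_compl.mp hv)
  have hload := hE _ hu
  rw [E.load_eq hu] at hload
  have hw : 0 ≤ ∑ b ∈ E.byz,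
    (((E.ops E.primary b).card : ℝ) + ((E.checkpointOps E.primary b).card : ℝ)) := by positivity
  have h1 : 0 ≤ 2 * (f : ℝ) / k * E.amount E.primary := by
    have : 0 ≤ E.amount E.primary := hC0.trans ha
    positivity
  have h2 : 0 ≤ 2 / (k : ℝ) * ∑ v ∈ E.byzᶜ, E.amount v := by positivity
  have h3 : (4 * f) * (C : ℝ) ≤ 4 * f * E.amount E.primary := by gcongr
  have h4 : 0 ≤ f * (C : ℝ) := by positivity
  -- With `a` the amount of the primary, its load is at least `(4f - 2) a + 5 (a + 2fC) ≥ (14f + 3)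
  -- C`, more than is needed.
  linarith

theorem tendsto_natCast_div_of_cube_isBigO {T : ℕ → ℝ}
    (hT : (fun f : ℕ => (3 * (f : ℝ) + 1) ^ 3) =O[atTop] T) :
    Tendsto (fun f : ℕ => (f : ℝ) / T f) atTop (𝓝 0) := by
  obtain ⟨c, hc, h⟩ := hT.exists_pos
  have hlim : Tendsto (fun f : ℕ => c * (f : ℝ)⁻¹) atTop (𝓝 0) := by
    simpa using tendsto_inv_atTop_nhds_zero_nat.const_mul c
  refine squeeze_zero_norm' ?_ hlim
  filter_upwards [h.bound, eventually_gt_atTop 0] with f hf hf0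
  have hf1 : (1 : ℝ) ≤ f := by exact_mod_cast hf0
  have hpos : (0 : ℝ) < (3 * f + 1) ^ 3 := by positivity
  rw [Real.norm_of_nonneg hpos.le] at hf
  have hT0 : 0 < ‖T f‖ := pos_of_mul_pos_right (hpos.trans_le hf) hc.le
  rw [norm_div, Real.norm_natCast, ← div_eq_mul_inv, div_le_div_iff₀ hT0 (by linarith)]
  refine le_trans ?_ hf
  have h2 : (f : ℝ) * f ≤ (3 * f + 1) * (3 * f + 1) := by gcongr <;> linarith
  nlinarith

theorem tendsto_throughput_coefficients_ratio {k : ℕ} (hk : 0 < k) :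
    Tendsto (fun f : ℕ => (k * (2 * f + 1) : ℝ) / (k * (14 * f + 3) + (6 * f + 2))
        / ((k * (3 * f + 1) : ℝ) / (k * (19 * f + 3) + (8 * f + 2)))) atTop
      (𝓝 ((16 + 38 * k) / (18 + 42 * k))) := by
  have hk' : (0 : ℝ) < k := Nat.cast_pos.mpr hk
  have hx : Tendsto (fun f : ℕ => (f : ℝ)⁻¹) atTop (𝓝 0) := tendsto_inv_atTop_nhds_zero_nat
  -- In the variable `x = 1/f` the ratio is a rational function continuous at `0`, and its value
  -- there is the limit.
  have hcont : ContinuousAt (fun x : ℝ => (k * (2 + x) : ℝ) / (k * (14 + 3 * x) + (6 + 2 * x))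
      / ((k * (3 + x) : ℝ) / (k * (19 + 3 * x) + (8 + 2 * x)))) 0 := by
    refine ContinuousAt.div (ContinuousAt.div (by fun_prop) (by fun_prop) ?_)
      (ContinuousAt.div (by fun_prop) (by fun_prop) ?_) ?_
    all_goals
      simp only [mul_zero, add_zero]
      positivity
  have hlim := hcont.tendsto.comp hx
  have hval : (k * (2 + 0) : ℝ) / (k * (14 + 3 * 0) + (6 + 2 * 0))
      / ((k * (3 + 0) : ℝ) / (k * (19 + 3 * 0) + (8 + 2 * 0)))
      = (16 + 38 * k) / (18 + 42 * k) := by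
    field_simp
    ring
  rw [hval] at hlim
  refine hlim.congr' ?_
  filter_upwards [eventually_gt_atTop 0] with f hf
  have hf' : (0 : ℝ) < f := Nat.cast_pos.mpr hf
  simp only [Function.comp]
  field_simp

theorem cube_isBigO_of_canFinish {k : ℕ} {Cmin : ℕ → ℕ} {T : ℕ → ℝ}
    (hCmin : (fun f : ℕ => (3 * (f : ℝ) + 1) ^ 2) =O[atTop] fun f : ℕ => (Cmin f : ℝ))
    (hT : ∀ f, CanFinish f k (T f) (Cmin f)) :
    (fun f : ℕ => (3 * (f : ℝ) + 1) ^ 3) =O[atTop] T := by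
  have h1 : (fun f : ℕ => (3 * (f : ℝ) + 1) ^ 3)
      =O[atTop] fun f : ℕ => (3 * (f : ℝ) + 1) * (Cmin f : ℝ) :=
    ((isBigO_refl (fun f : ℕ => 3 * (f : ℝ) + 1) atTop).mul hCmin).congr_left fun f => by ring
  refine h1.trans (IsBigO.of_bound' (Eventually.of_forall fun f => ?_))
  rw [Real.norm_of_nonneg (by positivity)]
  exact (hT f).mul_le.trans (le_abs_self _)

theorem mainTheorem5 (k : ℕ) (hk : 0 < k)
    -- minimum number of requests per leader, and epoch timer, of the system of `3 f + 1` replicas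
    (Cmin : ℕ → ℕ) (T : ℕ → ℝ)
    (hCmin : (fun f : ℕ => (3 * (f : ℝ) + 1) ^ 2) =O[atTop] fun f : ℕ => (Cmin f : ℝ))
    (hT : ∀ f, CanFinish f k (T f) (Cmin f)) :
    (∀ f : ℕ, 0 < T f →
      bestCaseThroughput f k (T f) =
        (k * (3 * f + 1) : ℝ) / (k * (19 * f + 3) + (8 * f + 2))) ∧
    (∀ f : ℕ, 0 < T f → 8 * k * f ≤ T f →
      worstCaseThroughput f k (T f) =
        (k * (2 * f + 1) : ℝ) / (k * (14 * f + 3) + (6 * f + 2)) * (1 - 8 * k * f / T f)) ∧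
    ((fun f : ℕ => (3 * (f : ℝ) + 1) ^ 3) =O[atTop] T) ∧
    Tendsto (fun f : ℕ => worstCaseThroughput f k (T f) / bestCaseThroughput f k (T f)) atTop
      (𝓝 ((16 + 38 * k) / (18 + 42 * k))) ∧
    (8 / 9 : ℝ) ≤ (16 + 38 * k) / (18 + 42 * k) := by
  have hT3 := cube_isBigO_of_canFinish hCmin hT
  have hk' : (0 : ℝ) < k := Nat.cast_pos.mpr hk
  refine ⟨fun f hf => bestCaseThroughput_eq hk hf,
    fun f hf hfT => worstCaseThroughput_eq hk hf hfT, hT3, ?_, ?_⟩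
  · have hratio := tendsto_natCast_div_of_cube_isBigO hT3
    have hfac : Tendsto (fun f : ℕ => 1 - 8 * k * ((f : ℝ) / T f)) atTop (𝓝 1) := by
      simpa using (hratio.const_mul (8 * (k : ℝ))).const_sub 1
    have hlim := (tendsto_throughput_coefficients_ratio hk).mul hfac
    rw [mul_one] at hlim
    refine hlim.congr' ?_
    -- This is the condition `8kf ≤ T` of the worst-case formula, which thus holds eventually.
    have hsmall : ∀ᶠ f : ℕ in atTop, (f : ℝ) / T f < (8 * (k : ℝ))⁻¹ :=
      hratio.eventually_lt_const (by positivity)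
    obtain ⟨c, hc, hbound⟩ := hT3.exists_pos
    filter_upwards [hsmall, hbound.bound] with f hs hb
    have hT0 : 0 < T f := by
      have h0 : 0 ≤ T f := le_trans (by positivity) (hT f).mul_le
      rw [Real.norm_of_nonneg (by positivity), Real.norm_of_nonneg h0] at hb
      exact pos_of_mul_pos_right (lt_of_lt_of_le (by positivity) hb) hc.le
    have hfT : 8 * k * f ≤ T f := by
      rw [div_lt_iff₀ hT0, ← div_eq_inv_mul, lt_div_iff₀ (by positivity)] at hs
      linarith
    rw [bestCaseThroughput_eq hk hT0, worstCaseThroughput_eq hk hT0 hfT]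
    ring
  -- The constant terms agree, `9 * 16 = 8 * 18`, while `9 * 38 > 8 * 42`.
  · rw [div_le_div_iff₀ (by norm_num) (by positivity)]
    linarith
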